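/- **Proposition (Descent cones of the $\ell_1$ norm).** For a convex cone $C\subset\mathbb R^d$, the statistical dimension is $\delta(C)=\mathbb E\,\|\Pi_{\overline C}(g)\|^2$, where $g$ is a standard normal vector in $\mathbb R^d$ and $\Pi_{\overline C}$ is the Euclidean projection onto the closure of $C$. The descent cone of $f:\mathbb R^d\to\mathbb R$ at $x$ is $\mathcal D(f,x)=\bigcup_{\tau>0}\{y\in\mathbb R^d: f(x+\tau y)\le f(x)\}$. For $\rho\in[0,1]$ and $\tau\ge 0$ put $$ J_\rho(\tau)=\rho(1+\tau^2)+(1-\rho)\sqrt{\tfrac2\pi}\Big[(1+\tau^2)\int_\tau^\infty e^{-u^2/2}\,du-\tau e^{-\tau^2/2}\Big], \qquad \psi(\rho)=\inf_{\tau\ge 0}J_\rho(\tau). $$ 1. Let $d\ge 1$ and let $x\in\mathbb R^d$ have exactly $s$ nonzero entries. Then $$ \frac{\delta(\mathcal D(\|\cdot\|_1,x))}{d}\le\psi(s/d), \qquad\text{and, if } s\ge 1,\qquad \psi(s/d)-\frac{2}{\sqrt{sd}}\le\frac{\delta(\mathcal D(\|\cdot\|_1,x))}{d}. $$ The expectation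 that defines $\delta(\mathcal D(\|\cdot\|_1,x))$ is finite. 2. The function $\psi$ maps $[0,1]$ into $[0,1]$. 3. For $0<\rho<1$, the stationary equation $$ \frac1\tau e^{-\tau^2/2}-\int_\tau^\infty e^{-u^2/2}\,du=\sqrt{\frac\pi2}\cdot\frac{\rho}{1-\rho} $$ has exactly one solution $\tau>0$, and this $\tau$ is the unique point of $[0,\infty)$ at which $J_\rho$ attains its infimum $\psi(\rho)$. -/

import Mathlib

open MeasureTheory ProbabilityTheory Set

/-- The Euclidean projection of `x` onto `S`: the point of `S` nearest to `x`
(the argmin of `‖x - y‖` over `y ∈ S`). It exists and is unique when `S` is nonempty,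
closed and convex; see `euclideanProj_eq_iff`. -/
noncomputable def euclideanProj {d : ℕ} (S : Set (EuclideanSpace ℝ (Fin d)))
    (x : EuclideanSpace ℝ (Fin d)) : EuclideanSpace ℝ (Fin d) :=
  Classical.epsilon fun y => y ∈ S ∧ ∀ z ∈ S, ‖x - y‖ ≤ ‖x - z‖

/-- On a nonempty closed convex set the projection is the unique nearest point. -/
theorem euclideanProj_eq_iff {d : ℕ} {S : Set (EuclideanSpace ℝ (Fin d))}
    (hne : S.Nonempty) (hc : IsClosed S) (hconv : Convex ℝ S) (x y : EuclideanSpace ℝ (Fin d)) :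
    euclideanProj S x = y ↔ (y ∈ S ∧ ∀ z ∈ S, ‖x - y‖ ≤ ‖x - z‖) := by
  have hbdd : BddBelow (Set.range fun w : S => ‖x - w‖) := ⟨0, by rintro _ ⟨w, rfl⟩; positivity⟩
  have key : ∀ v, (v ∈ S ∧ ∀ z ∈ S, ‖x - v‖ ≤ ‖x - z‖) →
      v ∈ S ∧ ∀ w ∈ S, inner ℝ (x - v) (w - v) ≤ 0 := by
    rintro v ⟨hv, hmin⟩
    refine ⟨hv, (norm_eq_iInf_iff_real_inner_le_zero hconv hv).1 ?_⟩
    have : Nonempty S := ⟨⟨v, hv⟩⟩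
    exact le_antisymm (le_ciInf fun w => hmin w w.2) (ciInf_le hbdd ⟨v, hv⟩)
  have hspec : euclideanProj S x ∈ S ∧ ∀ z ∈ S, ‖x - euclideanProj S x‖ ≤ ‖x - z‖ := by
    apply Classical.epsilon_spec (p := fun y => y ∈ S ∧ ∀ z ∈ S, ‖x - y‖ ≤ ‖x - z‖)
    obtain ⟨v, hv, h⟩ := exists_norm_eq_iInf_of_complete_convex hne hc.isComplete hconv x
    exact ⟨v, hv, fun z hz => h ▸ ciInf_le hbdd ⟨z, hz⟩⟩
  constructor
  · rintro rfl
    exact hspec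
  · intro hy
    obtain ⟨ha, ha'⟩ := key _ hspec
    obtain ⟨hb, hb'⟩ := key _ hy
    have h1 := ha' _ hb
    have h2 := hb' _ ha
    set a := euclideanProj S x
    have h3 : inner ℝ (a - y) (a - y) ≤ 0 := by
      have e : inner ℝ (a - y) (a - y) = inner ℝ (x - a) (y - a) + inner ℝ (x - y) (a - y) := by
        simp only [inner_sub_left, inner_sub_right]
        ring
      linarith
    exact sub_eq_zero.1 (norm_eq_zero.1 (by rw [real_inner_self_eq_norm_sq] at h3; nlinarith [norm_nonneg (a - y)]))

/-- The statistical dimension of a convex cone `C ⊆ ℝᵈ`: the expectation of `‖Π(g)‖²`, where `g`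
is a standard normal vector and `Π` is the Euclidean projection onto the closure of `C`. -/
noncomputable def statDim {d : ℕ} (C : Set (EuclideanSpace ℝ (Fin d))) : ℝ :=
  ∫ g, ‖euclideanProj (closure C) g‖ ^ 2 ∂(stdGaussian (EuclideanSpace ℝ (Fin d)))

/-- The descent cone of `f` at `x`. -/
def descentCone {d : ℕ} (f : EuclideanSpace ℝ (Fin d) → ℝ) (x : EuclideanSpace ℝ (Fin d)) :
    Set (EuclideanSpace ℝ (Fin d)) :=
  ⋃ τ : {τ : ℝ // 0 < τ}, {y | f (x + (τ : ℝ) • y) ≤ f x}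

/-- The `ℓ₁` norm on `ℝᵈ`. -/
noncomputable def l1norm {d : ℕ} (x : EuclideanSpace ℝ (Fin d)) : ℝ := ∑ i, |x i|

/-- The function of `τ` inside the infimum that defines `ψ(ρ)`. -/
noncomputable def psiObjective (ρ τ : ℝ) : ℝ :=
  ρ * (1 + τ ^ 2) + (1 - ρ) * √(2 / Real.pi) *
    ((1 + τ ^ 2) * (∫ u in Ioi τ, Real.exp (-u ^ 2 / 2)) - τ * Real.exp (-τ ^ 2 / 2))

/-- `ψ(ρ)`, the infimum of `psiObjective ρ τ` over `τ ≥ 0`. -/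
noncomputable def psi (ρ : ℝ) : ℝ := sInf (psiObjective ρ '' Ici 0)

/-- The stationary equation for `τ` at sparsity level `ρ`. -/
def IsStationaryTau (ρ τ : ℝ) : Prop :=
  1 / τ * Real.exp (-τ ^ 2 / 2) - (∫ u in Ioi τ, Real.exp (-u ^ 2 / 2)) =
    √(Real.pi / 2) * (ρ / (1 - ρ))

/-!
The `ℓ₁` norm is piecewise linear, so its descent cone at a point with support `S` and signs `e` is
the closed polyhedral cone on which the directional derivative `∑_S eᵢ yᵢ + ∑_{Sᶜ} |yᵢ|` is
nonpositive (`descentCone_l1norm`). Its polar cone is generated by the subdifferential `∂‖·‖₁`,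
hence by Moreau's decomposition
`‖Π(g)‖² = min_{t ≥ 0} dist²(g, t ∂‖·‖₁)`, where
`dist²(g, t ∂‖·‖₁) = ∑_S (eᵢ gᵢ - t)² + ∑_{Sᶜ} (|gᵢ| - t)₊²`
(`norm_euclideanProj_l1Cone_sq_le`, `l1Threshold_spec`). One-dimensional Gaussian integrals
identify the expectation of this squared distance with `d J_ρ(t)`, `ρ = |S| / d`
(`integral_l1DistSq`), and the upper bound follows by exchanging the minimum with the expectation.

For the lower bound let `τ(g)` be the minimizing `t` and `t₀` its mean. By convexity of the squared
distance in `t`,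
`𝔼 dist²(g, t₀ ∂‖·‖₁) - 𝔼 ‖Π(g)‖² ≤ Cov(τ(g), h(g))`,
where `-h(g)` is the derivative of the squared distance at `t₀`. The function `τ` is
`1 / √|S|`-Lipschitz because `τ(g) = ⟨g - Π(g), e⟩ / |S|`, and `h` is `2 √d`-Lipschitz. The Gaussian
covariance inequality `covariance_stdGaussian_le_of_lipschitzWith` bounds the covariance by the
product `2 √(d / |S|)` of the two constants. It is proved by differentiating
`θ ↦ 𝔼 f(X) h(cos θ X + sin θ Y)` between `0` and `π / 2`, using rotation invariance of the Gaussian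
law of `(X, Y)` and, in place of integration by parts, its invariance under reflections.

For `0 < ρ < 1` and `t > 0` the derivative of `J_ρ` is a positive multiple of
`√(π / 2) ρ / (1 - ρ) - (exp (-t² / 2) / t - ∫_t^∞ exp (-u² / 2) du)`, and the term in parentheses
decreases strictly from `∞` to `0`, so that `J_ρ` strictly decreases up to the stationary point and
strictly increases after it (`exists_unique_stationary_minimizer`).
-/

/-! ### A Gaussian covariance inequality -/

section GaussianCovariance

open scoped NNReal

variable {E : Type*} [NormedAddCommGroup E] [InnerProductSpace ℝ E] [FiniteDimensional ℝ E]
  [MeasurableSpace E] [BorelSpace E]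

theorem LipschitzWith.memLp_of_isGaussian {F : Type*} [NormedAddCommGroup F] [NormedSpace ℝ F]
    [MeasurableSpace F] [BorelSpace F] [CompleteSpace F] [SecondCountableTopology F]
    {μ : Measure F} [IsGaussian μ] {C : ℝ≥0} {u : F → ℝ} (hu : LipschitzWith C u) :
    MemLp u 2 μ := by
  have h0 : LipschitzWith C (fun x => u x - u 0) :=
    LipschitzWith.of_dist_le_mul fun x y => by simpa using hu.dist_le_mul x y
  have h1 : MemLp (fun x => u x - u 0) 2 μ :=
    h0.comp_memLp (by simp) (IsGaussian.memLp_two_id (μ := μ))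
  convert h1.add (memLp_const (u 0)) using 1
  ext x
  simp

theorem integral_sq_dual_stdGaussian (l : StrongDual ℝ E) :
    ∫ v, l v ^ 2 ∂(stdGaussian E) = ‖l‖ ^ 2 := by
  rw [← variance_dual_stdGaussian l, variance_of_integral_eq_zero (by fun_prop) (by simp)]

/-- The covariance of a Lipschitz function with a linear functional under the standard Gaussian
measure. Averaging over the reflection in the hyperplane `l = 0`, which preserves the measure and
changes the sign of `l`, replaces `u` by its increment along the normal of that hyperplane; in this
way no integration by parts is needed. -/
theorem abs_integral_mul_dual_stdGaussian_le {C : ℝ≥0} {u : E → ℝ} (hu : LipschitzWith C u)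
    (l : StrongDual ℝ E) : |∫ v, u v * l v ∂(stdGaussian E)| ≤ C * ‖l‖ := by
  rcases eq_or_ne l 0 with rfl | hl
  · simp
  set a : E := (InnerProductSpace.toDual ℝ E).symm l with ha
  have hla : ∀ v, l v = inner ℝ a v := fun v => by simp [ha]
  have hna : ‖a‖ = ‖l‖ := by simp [ha]
  have hlpos : 0 < ‖l‖ := norm_pos_iff.2 hl
  set R := (Submodule.span ℝ {a})ᗮ.reflection with hR
  have hRv : ∀ v, R v = v - (2 * (l v / ‖l‖ ^ 2)) • a := fun v => by
    rw [hR, Submodule.reflection_orthogonal_apply, Submodule.reflection_singleton_apply,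
      ← hla, hna, neg_sub, two_smul, two_mul, add_smul]
    rfl
  have hlR : ∀ v, l (R v) = - l v := fun v => by
    rw [hRv, map_sub, map_smul, hla a, real_inner_self_eq_norm_sq, hna, smul_eq_mul]
    field_simp
    ring
  have hmap : (stdGaussian E).map R = stdGaussian E := stdGaussian_map R
  have hu2 : MemLp u 2 (stdGaussian E) := hu.memLp_of_isGaussian
  have hl2 : MemLp l 2 (stdGaussian E) := l.lipschitz.memLp_of_isGaussian
  have hint : Integrable (fun v => u v * l v) (stdGaussian E) := hu2.integrable_mul hl2
  have hcont : Continuous u := hu.continuous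
  have hrefl : ∫ v, u v * l v ∂(stdGaussian E) = ∫ v, u (R v) * (- l v) ∂(stdGaussian E) := by
    conv_lhs => rw [← hmap]
    rw [integral_map R.continuous.aemeasurable
      (Continuous.aestronglyMeasurable (by fun_prop))]
    simp_rw [hlR]
  have hint' : Integrable (fun v => u (R v) * (- l v)) (stdGaussian E) := by
    have : Integrable (fun v => u v * l v) ((stdGaussian E).map R) := hmap.symm ▸ hint
    have := this.comp_measurable R.continuous.measurable
    refine this.congr (ae_of_all _ fun v => ?_)
    simp [hlR]
  have hsum : 2 * ∫ v, u v * l v ∂(stdGaussian E)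
      = ∫ v, (u v * l v + u (R v) * (- l v)) ∂(stdGaussian E) := by
    rw [integral_add hint hint', ← hrefl]; ring
  have hpt : ∀ v, ‖u v * l v + u (R v) * (- l v)‖ ≤ 2 * C / ‖l‖ * l v ^ 2 := fun v => by
    have h1 : |u v - u (R v)| ≤ C * (2 * (|l v| / ‖l‖)) := by
      have := hu.dist_le_mul v (R v)
      rw [Real.dist_eq, dist_eq_norm, hRv v, sub_sub_cancel, norm_smul, hna] at this
      rw [hRv v]
      convert this using 2
      rw [norm_mul, norm_div]
      simp only [Real.norm_eq_abs, abs_two, norm_pow, abs_norm]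
      field_simp
    rw [show u v * l v + u (R v) * (- l v) = (u v - u (R v)) * l v by ring, norm_mul,
      Real.norm_eq_abs, Real.norm_eq_abs]
    calc |u v - u (R v)| * |l v| ≤ C * (2 * (|l v| / ‖l‖)) * |l v| := by gcongr
      _ = 2 * C / ‖l‖ * |l v| ^ 2 := by ring
      _ = 2 * C / ‖l‖ * l v ^ 2 := by rw [sq_abs]
  have hbound := norm_integral_le_of_norm_le (μ := stdGaussian E)
    (hl2.integrable_sq.const_mul (2 * C / ‖l‖)) (ae_of_all _ hpt)
  rw [integral_const_mul, integral_sq_dual_stdGaussian, ← hsum, norm_mul, Real.norm_eq_abs,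
    Real.norm_eq_abs, abs_two] at hbound
  have : 2 * C / ‖l‖ * ‖l‖ ^ 2 = 2 * (C * ‖l‖) := by field_simp
  linarith

/-- The derivative of the interpolation `θ ↦ 𝔼 f(X) h(cos θ • X + sin θ • Y)` between
`𝔼 f(X) h(X)` and `𝔼 f(X) 𝔼 h(Y)`, with its lower bound. By rotation invariance the derivative
equals `𝔼 f(cos θ • W - sin θ • V) (Dh(W) V)`, where for fixed `W` the expectation over `V` pairs
a Lipschitz function with a linear functional. -/
theorem hasDerivAt_gaussian_interpolation {K L : ℝ≥0} {f h : E → ℝ} (hf : LipschitzWith K f)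
    (hh : LipschitzWith L h) (hd : ∀ᵐ x ∂(stdGaussian E), DifferentiableAt ℝ h x)
    {θ : ℝ} (hθ : 0 ≤ Real.sin θ) :
    ∃ D : ℝ, -(K * L * Real.sin θ) ≤ D ∧ HasDerivAt (fun t => ∫ p, f p.1 *
      h (Real.cos t • p.1 + Real.sin t • p.2) ∂((stdGaussian E).prod (stdGaussian E))) D θ := by
  set γ := stdGaussian E with hγ
  have hfc : Continuous f := hf.continuous
  have hhc : Continuous h := hh.continuous
  set D' : E × E → ℝ := fun p => f p.1 * fderiv ℝ h (Real.cos θ • p.1 + Real.sin θ • p.2)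
    (-Real.sin θ • p.1 + Real.cos θ • p.2) with hD'
  have hD'meas : Measurable D' := by
    refine (hfc.measurable.comp measurable_fst).mul ?_
    have h1 : Measurable fun p : E × E => fderiv ℝ h (Real.cos θ • p.1 + Real.sin θ • p.2) :=
      (measurable_fderiv ℝ h).comp (by fun_prop)
    exact isBoundedBilinearMap_apply.continuous.measurable.comp (h1.prodMk (by fun_prop))
  have hrot : ∀ t, (γ.prod γ).map (ContinuousLinearMap.rotation t) = γ.prod γ := fun t =>
    IsGaussian.map_rotation_eq_self (by simp [hγ]) t
  have hf2 : MemLp (fun p : E × E => f p.1) 2 (γ.prod γ) :=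
    (hf.comp LipschitzWith.prod_fst).memLp_of_isGaussian
  have hn2 : MemLp (fun p : E × E => ‖p.1‖ + ‖p.2‖) 2 (γ.prod γ) :=
    ((lipschitzWith_one_norm.comp LipschitzWith.prod_fst).memLp_of_isGaussian).add
      ((lipschitzWith_one_norm.comp LipschitzWith.prod_snd).memLp_of_isGaussian)
  have hLip : ∀ t, LipschitzWith (L * (‖Real.cos t‖₊ + ‖Real.sin t‖₊))
      (fun p : E × E => h (Real.cos t • p.1 + Real.sin t • p.2)) := fun t => by
    refine hh.comp (((lipschitzWith_smul _).comp LipschitzWith.prod_fst |>.add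
      ((lipschitzWith_smul _).comp LipschitzWith.prod_snd)).weaken ?_)
    simp
  have hlip : ∀ p : E × E, LipschitzOnWith (Real.nnabs (|f p.1| * (L * (‖p.1‖ + ‖p.2‖))))
      (fun t => f p.1 * h (Real.cos t • p.1 + Real.sin t • p.2)) univ := fun p => by
    refine LipschitzOnWith.of_dist_le_mul fun s _ t _ => ?_
    have h1 := hh.dist_le_mul (Real.cos s • p.1 + Real.sin s • p.2)
      (Real.cos t • p.1 + Real.sin t • p.2)
    have h2 : dist (Real.cos s • p.1 + Real.sin s • p.2) (Real.cos t • p.1 + Real.sin t • p.2)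
        ≤ (‖p.1‖ + ‖p.2‖) * dist s t := by
      refine (dist_add_add_le _ _ _ _).trans ?_
      rw [dist_eq_norm, dist_eq_norm, ← sub_smul, ← sub_smul, norm_smul, norm_smul, add_mul,
        Real.dist_eq, mul_comm _ |s - t|, mul_comm _ |s - t|]
      gcongr
      · simpa [Real.dist_eq] using Real.lipschitzWith_cos.dist_le_mul s t
      · simpa [Real.dist_eq] using Real.lipschitzWith_sin.dist_le_mul s t
    rw [Real.dist_eq, ← mul_sub, abs_mul, ← Real.dist_eq, Real.coe_nnabs,
      abs_of_nonneg (show 0 ≤ |f p.1| * (L * (‖p.1‖ + ‖p.2‖)) by positivity)]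
    calc |f p.1| * dist _ _ ≤ |f p.1| * (L * ((‖p.1‖ + ‖p.2‖) * dist s t)) := by
          gcongr; exact h1.trans (by gcongr)
      _ = _ := by ring
  have hdiff : ∀ᵐ p ∂(γ.prod γ), HasDerivAt
      (fun t => f p.1 * h (Real.cos t • p.1 + Real.sin t • p.2)) (D' p) θ := by
    have h1 : ∀ᵐ p ∂((γ.prod γ).map (ContinuousLinearMap.rotation θ)),
        DifferentiableAt ℝ h p.1 := by
      rw [hrot θ]
      exact measurePreserving_fst.quasiMeasurePreserving.ae hd
    filter_upwards [ae_of_ae_map (by fun_prop) h1] with p hp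
    have hcurve : HasDerivAt (fun t => Real.cos t • p.1 + Real.sin t • p.2)
        (-Real.sin θ • p.1 + Real.cos θ • p.2) θ :=
      ((Real.hasDerivAt_cos θ).smul_const p.1).add ((Real.hasDerivAt_sin θ).smul_const p.2)
    exact (HasFDerivAt.comp_hasDerivAt θ (by exact hp.hasFDerivAt) hcurve).const_mul (f p.1)
  obtain ⟨hint, hder⟩ := hasDerivAt_integral_of_dominated_loc_of_lip (μ := γ.prod γ)
    (F := fun t p => f p.1 * h (Real.cos t • p.1 + Real.sin t • p.2)) (F' := D') (x₀ := θ)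
    (bound := fun p => |f p.1| * (L * (‖p.1‖ + ‖p.2‖))) (s := univ) Filter.univ_mem
    (Filter.Eventually.of_forall fun t => Continuous.aestronglyMeasurable (by fun_prop))
    (hf2.integrable_mul (hLip θ).memLp_of_isGaussian) hD'meas.aestronglyMeasurable
    (ae_of_all _ hlip)
    (hf2.abs.integrable_mul (hn2.const_mul (L : ℝ))) hdiff
  refine ⟨_, ?_, hder⟩
  set G : E × E → ℝ := fun q => f (Real.cos θ • q.1 - Real.sin θ • q.2) *
    fderiv ℝ h q.1 q.2 with hG
  have hGmeas : Measurable G := by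
    refine (hfc.measurable.comp (by fun_prop)).mul ?_
    exact isBoundedBilinearMap_apply.continuous.measurable.comp
      (((measurable_fderiv ℝ h).comp measurable_fst).prodMk measurable_snd)
  have hGD : ∀ p, G (ContinuousLinearMap.rotation θ p) = D' p := fun p => by
    simp only [hG, hD', ContinuousLinearMap.rotation_apply]
    congr 2
    have := Real.sin_sq_add_cos_sq θ
    rw [smul_add, smul_add, smul_smul, smul_smul, smul_smul, smul_smul]
    have e : (1 : ℝ) = Real.cos θ * Real.cos θ - Real.sin θ * -Real.sin θ := by linarith
    conv_rhs => rw [← one_smul ℝ p.1, e, sub_smul]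
    rw [mul_comm (Real.sin θ) (Real.cos θ)]
    abel
  have hGint : Integrable G (γ.prod γ) := by
    rw [← hrot θ, integrable_map_measure hGmeas.aestronglyMeasurable (by fun_prop)]
    exact hint.congr (ae_of_all _ fun p => (hGD p).symm)
  have hDG : ∫ p, D' p ∂(γ.prod γ) = ∫ q, G q ∂(γ.prod γ) := by
    conv_rhs => rw [← hrot θ]
    rw [integral_map (by fun_prop) hGmeas.aestronglyMeasurable]
    simp_rw [hGD]
  rw [hDG, integral_prod _ hGint]
  have hinner : ∀ w, -(K * L * Real.sin θ) ≤ ∫ v, G (w, v) ∂γ := fun w => by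
    have hu : LipschitzWith (K * ‖Real.sin θ‖₊)
        (fun v => f (Real.cos θ • w - Real.sin θ • v)) := by
      refine hf.comp (LipschitzWith.of_dist_le_mul fun x y => ?_)
      rw [dist_sub_left, dist_smul₀]
      simp
    have h1 := abs_integral_mul_dual_stdGaussian_le hu (fderiv ℝ h w)
    have h2 : ‖fderiv ℝ h w‖ ≤ L := norm_fderiv_le_of_lipschitz ℝ hh
    have h3 : ((K * ‖Real.sin θ‖₊ : ℝ≥0) : ℝ) * ‖fderiv ℝ h w‖ ≤ K * L * Real.sin θ := by
      rw [NNReal.coe_mul, coe_nnnorm, Real.norm_eq_abs, abs_of_nonneg hθ]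
      calc (K : ℝ) * Real.sin θ * ‖fderiv ℝ h w‖ ≤ K * Real.sin θ * L := by gcongr
        _ = K * L * Real.sin θ := by ring
    exact neg_le_of_abs_le (h1.trans h3)
  calc -(K * L * Real.sin θ) = ∫ _, -(K * L * Real.sin θ) ∂γ := by simp
    _ ≤ _ := integral_mono (integrable_const _) hGint.integral_prod_left hinner

/-- **Gaussian covariance inequality**, the bilinear form of the Gaussian Poincaré inequality for
Lipschitz functions. -/
theorem covariance_stdGaussian_le_of_lipschitzWith {K L : ℝ≥0} {f h : E → ℝ}
    (hf : LipschitzWith K f) (hh : LipschitzWith L h)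
    (hd : ∀ᵐ x ∂(stdGaussian E), DifferentiableAt ℝ h x) :
    ∫ x, f x * h x ∂(stdGaussian E) -
      (∫ x, f x ∂(stdGaussian E)) * ∫ x, h x ∂(stdGaussian E) ≤ K * L := by
  set γ := stdGaussian E with hγ
  set φ : ℝ → ℝ := fun t => ∫ p, f p.1 * h (Real.cos t • p.1 + Real.sin t • p.2) ∂(γ.prod γ)
    with hφ
  have hsin : ∀ t ∈ Icc 0 (Real.pi / 2), 0 ≤ Real.sin t := fun t ht =>
    Real.sin_nonneg_of_nonneg_of_le_pi ht.1 (by linarith [ht.2, Real.pi_pos])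
  have hder : ∀ t ∈ Icc 0 (Real.pi / 2), ∃ D : ℝ, 0 ≤ D ∧
      HasDerivAt (fun t => φ t - K * L * Real.cos t) D t := fun t ht => by
    obtain ⟨D, hD, hDd⟩ := hasDerivAt_gaussian_interpolation hf hh hd (hsin t ht)
    refine ⟨D - K * L * -Real.sin t, by linarith, hDd.sub ((Real.hasDerivAt_cos t).const_mul _)⟩
  have hmono : MonotoneOn (fun t => φ t - K * L * Real.cos t) (Icc 0 (Real.pi / 2)) := by
    refine monotoneOn_of_deriv_nonneg (convex_Icc _ _) (fun t ht => ?_) (fun t ht => ?_)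
      (fun t ht => ?_)
    · obtain ⟨D, -, hD⟩ := hder t ht
      exact hD.continuousAt.continuousWithinAt
    · obtain ⟨D, -, hD⟩ := hder t (interior_subset ht)
      exact hD.differentiableAt.differentiableWithinAt
    · obtain ⟨D, hD0, hD⟩ := hder t (interior_subset ht)
      rwa [hD.deriv]
  have hpi : (0 : ℝ) ≤ Real.pi / 2 := by positivity
  have hle := hmono (left_mem_Icc.2 hpi) (right_mem_Icc.2 hpi) hpi
  have h0 : φ 0 = ∫ x, f x * h x ∂γ := by
    simp only [hφ, Real.cos_zero, Real.sin_zero, one_smul, zero_smul, add_zero]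
    rw [← measurePreserving_fst (μ := γ) (ν := γ) |>.map_eq, integral_map (by fun_prop)]
    · rw [measurePreserving_fst.map_eq]
    · exact (hf.continuous.mul hh.continuous).aestronglyMeasurable
  have h1 : φ (Real.pi / 2) = (∫ x, f x ∂γ) * ∫ x, h x ∂γ := by
    simp only [hφ, Real.cos_pi_div_two, Real.sin_pi_div_two, one_smul, zero_smul, zero_add]
    exact integral_prod_mul f h
  simp only [h0, h1, Real.cos_zero, Real.cos_pi_div_two] at hle
  linarith

end GaussianCovariance

/-! ### The Gaussian tail and the truncated second moment -/

section GaussianTail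

theorem integrable_exp_neg_sq_div_two : Integrable fun u : ℝ => Real.exp (-u ^ 2 / 2) := by
  convert integrable_exp_neg_mul_sq (b := 1 / 2) (by norm_num) using 3
  ring

theorem integral_Ioi_zero_exp_neg_sq_div_two :
    ∫ u in Ioi (0 : ℝ), Real.exp (-u ^ 2 / 2) = √(Real.pi / 2) := by
  have h : ∀ u : ℝ, -u ^ 2 / 2 = -(1 / 2) * u ^ 2 := fun u => by ring
  simp_rw [h, integral_gaussian_Ioi]
  rw [show Real.pi / (1 / 2) = 2 ^ 2 * (Real.pi / 2) by ring, Real.sqrt_mul (by norm_num),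
    Real.sqrt_sq (by norm_num)]
  ring

theorem integral_Ioi_exp_neg_sq_div_two_nonneg (t : ℝ) :
    0 ≤ ∫ u in Ioi t, Real.exp (-u ^ 2 / 2) :=
  integral_nonneg fun _ => (Real.exp_pos _).le

theorem integral_Ioi_exp_neg_sq_div_two_le {t : ℝ} (ht : 0 ≤ t) :
    ∫ u in Ioi t, Real.exp (-u ^ 2 / 2) ≤ √(Real.pi / 2) := by
  rw [← integral_Ioi_zero_exp_neg_sq_div_two]
  exact setIntegral_mono_set integrable_exp_neg_sq_div_two.integrableOn
    (ae_of_all _ fun _ => (Real.exp_pos _).le) (Ioi_subset_Ioi ht).eventuallyLE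

theorem hasDerivAt_exp_neg_sq_div_two (t : ℝ) :
    HasDerivAt (fun u : ℝ => Real.exp (-u ^ 2 / 2)) (-(t * Real.exp (-t ^ 2 / 2))) t := by
  have h : HasDerivAt (fun u : ℝ => -u ^ 2 / 2) (-t) t :=
    ((hasDerivAt_pow 2 t).neg.div_const 2).congr_deriv (by simp; ring)
  exact h.exp.congr_deriv (by ring)

theorem hasDerivAt_integral_Ioi_exp_neg_sq_div_two (t : ℝ) :
    HasDerivAt (fun a : ℝ => ∫ u in Ioi a, Real.exp (-u ^ 2 / 2)) (-Real.exp (-t ^ 2 / 2)) t := by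
  have hi := integrable_exp_neg_sq_div_two
  have hc : Continuous fun u : ℝ => Real.exp (-u ^ 2 / 2) := by fun_prop
  have h : (fun a : ℝ => ∫ u in Ioi a, Real.exp (-u ^ 2 / 2)) = fun a =>
      (∫ u in Ioi (0 : ℝ), Real.exp (-u ^ 2 / 2)) - ∫ u in (0 : ℝ)..a, Real.exp (-u ^ 2 / 2) := by
    ext a
    rw [← intervalIntegral.integral_Ioi_sub_Ioi' hi.integrableOn hi.integrableOn]
    ring
  rw [h]
  exact (intervalIntegral.integral_hasDerivAt_right hi.intervalIntegrable
    (hc.stronglyMeasurableAtFilter _ _) hc.continuousAt).const_sub _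

theorem integrable_pow_mul_exp_neg_sq_div_two (n : ℕ) :
    Integrable fun u : ℝ => u ^ n * Real.exp (-u ^ 2 / 2) := by
  have h := integrable_rpow_mul_exp_neg_mul_sq (b := 1 / 2) (by norm_num) (s := n)
    (by have : (0 : ℝ) ≤ n := n.cast_nonneg
        linarith)
  refine h.congr (ae_of_all _ fun u => ?_)
  simp only [Real.rpow_natCast]
  congr 2
  ring

theorem tendsto_pow_mul_exp_neg_sq_div_two (n : ℕ) :
    Filter.Tendsto (fun u : ℝ => u ^ n * Real.exp (-u ^ 2 / 2)) Filter.atTop (nhds 0) := by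
  have h := (tendsto_rpow_abs_mul_exp_neg_mul_sq_cocompact (a := 1 / 2) (by norm_num) n).mono_left
    atTop_le_cocompact
  refine h.congr' ?_
  filter_upwards [Filter.eventually_ge_atTop 0] with u hu
  rw [abs_of_nonneg hu, Real.rpow_natCast]
  congr 2
  ring

theorem integral_Ioi_sub_sq_mul_exp_neg_sq_div_two (t : ℝ) :
    ∫ u in Ioi t, (u - t) ^ 2 * Real.exp (-u ^ 2 / 2) =
      (1 + t ^ 2) * (∫ u in Ioi t, Real.exp (-u ^ 2 / 2)) - t * Real.exp (-t ^ 2 / 2) := by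
  have hi := integrable_exp_neg_sq_div_two
  have hi2 : Integrable fun u : ℝ => (u - t) ^ 2 * Real.exp (-u ^ 2 / 2) := by
    refine (((integrable_pow_mul_exp_neg_sq_div_two 2).sub
      ((integrable_pow_mul_exp_neg_sq_div_two 1).const_mul (2 * t))).add
        (hi.const_mul (t ^ 2))).congr (ae_of_all _ fun u => ?_)
    simp only [Pi.add_apply, Pi.sub_apply]
    ring
  -- `(2t - u) exp (-u²/2)` is a primitive of the difference of the two integrands
  have hder : ∀ u : ℝ, HasDerivAt (fun u => (2 * t - u) * Real.exp (-u ^ 2 / 2))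
      ((u - t) ^ 2 * Real.exp (-u ^ 2 / 2) - (1 + t ^ 2) * Real.exp (-u ^ 2 / 2)) u := fun u =>
    (((hasDerivAt_id u).const_sub (2 * t)).mul (hasDerivAt_exp_neg_sq_div_two u)).congr_deriv
      (by simp only [id]; ring)
  have hlim : Filter.Tendsto (fun u : ℝ => (2 * t - u) * Real.exp (-u ^ 2 / 2))
      Filter.atTop (nhds 0) := by
    have := ((tendsto_pow_mul_exp_neg_sq_div_two 0).const_mul (2 * t)).sub
      (tendsto_pow_mul_exp_neg_sq_div_two 1)
    simp only [mul_zero, sub_zero] at this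
    refine this.congr fun u => ?_
    ring
  have h := integral_Ioi_of_hasDerivAt_of_tendsto' (a := t) (fun u _ => hder u)
    (hi2.sub (hi.const_mul (1 + t ^ 2))).integrableOn hlim
  rw [integral_sub hi2.integrableOn (hi.const_mul _).integrableOn, integral_const_mul] at h
  linarith

theorem two_mul_inv_sqrt_two_mul_pi : 2 * (√(2 * Real.pi))⁻¹ = √(2 / Real.pi) := by
  have h : (2 : ℝ) / Real.pi = 2 ^ 2 * (2 * Real.pi)⁻¹ := by
    field_simp
  rw [h, Real.sqrt_mul (x := 2 ^ 2) (by norm_num), Real.sqrt_sq (by norm_num), Real.sqrt_inv]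

/-- The second moment of the soft-thresholded standard normal variable. -/
theorem integral_max_abs_sub_sq_gaussianReal {t : ℝ} (ht : 0 ≤ t) :
    ∫ x, max (|x| - t) 0 ^ 2 ∂(gaussianReal 0 1) = √(2 / Real.pi) *
      ((1 + t ^ 2) * (∫ u in Ioi t, Real.exp (-u ^ 2 / 2)) - t * Real.exp (-t ^ 2 / 2)) := by
  rw [integral_gaussianReal_eq_integral_smul one_ne_zero]
  have h1 : ∀ x : ℝ, gaussianPDFReal 0 1 x • max (|x| - t) 0 ^ 2 =
      (fun y => (√(2 * Real.pi))⁻¹ * (max (y - t) 0 ^ 2 * Real.exp (-y ^ 2 / 2))) |x| := fun x => by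
    simp only [gaussianPDFReal, NNReal.coe_one, mul_one, sub_zero, smul_eq_mul, sq_abs]
    ring
  rw [integral_congr_ae (ae_of_all _ h1),
    integral_comp_abs (f := fun y => (√(2 * Real.pi))⁻¹ *
      (max (y - t) 0 ^ 2 * Real.exp (-y ^ 2 / 2))), integral_const_mul,
    setIntegral_eq_of_subset_of_forall_sdiff_eq_zero measurableSet_Ioi (Ioi_subset_Ioi ht),
    ← integral_Ioi_sub_sq_mul_exp_neg_sq_div_two, ← two_mul_inv_sqrt_two_mul_pi, mul_assoc]
  · congr 2
    refine setIntegral_congr_fun measurableSet_Ioi fun x hx => ?_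
    rw [max_eq_left (sub_nonneg.2 (le_of_lt hx))]
  · rintro x ⟨-, hx⟩
    rw [max_eq_right (sub_nonpos.2 (not_lt.1 hx))]
    simp

theorem integral_sq_gaussianReal : ∫ x, x ^ 2 ∂(gaussianReal 0 1) = 1 := by
  have := variance_of_integral_eq_zero (μ := gaussianReal 0 1) (X := id) (by fun_prop) (by simp)
  simpa using this.symm

theorem integral_sub_sq_gaussianReal {e : ℝ} (he : e ^ 2 = 1) (t : ℝ) :
    ∫ x, (e * x - t) ^ 2 ∂(gaussianReal 0 1) = 1 + t ^ 2 := by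
  have h2 : MemLp id 2 (gaussianReal 0 1) := IsGaussian.memLp_two_id
  have hi1 : Integrable (fun x : ℝ => x) (gaussianReal 0 1) := h2.integrable (by norm_num)
  have hi2 : Integrable (fun x : ℝ => x ^ 2) (gaussianReal 0 1) := h2.integrable_sq
  have h : ∀ x : ℝ, (e * x - t) ^ 2 = x ^ 2 - 2 * e * t * x + t ^ 2 := fun x => by
    linear_combination x ^ 2 * he
  have hi3 : Integrable (fun x : ℝ => x ^ 2 - 2 * e * t * x) (gaussianReal 0 1) :=
    hi2.sub (hi1.const_mul _)
  simp_rw [h]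
  rw [integral_add hi3 (integrable_const _), integral_sub hi2 (hi1.const_mul _), integral_const_mul,
    integral_sq_gaussianReal]
  simp

end GaussianTail

/-! ### The functions `psiObjective` and `psi` -/

section Psi

theorem psiObjective_eq_integral (ρ : ℝ) {t : ℝ} (ht : 0 ≤ t) :
    psiObjective ρ t =
      ρ * (1 + t ^ 2) + (1 - ρ) * ∫ x, max (|x| - t) 0 ^ 2 ∂(gaussianReal 0 1) := by
  rw [integral_max_abs_sub_sq_gaussianReal ht, psiObjective, mul_assoc (1 - ρ)]

theorem psiObjective_nonneg {ρ : ℝ} (hρ : ρ ∈ Icc (0 : ℝ) 1) {t : ℝ} (ht : 0 ≤ t) :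
    0 ≤ psiObjective ρ t := by
  rw [psiObjective_eq_integral ρ ht]
  have h1 := hρ.1
  have h2 := sub_nonneg.2 hρ.2
  have h3 : 0 ≤ ∫ x, max (|x| - t) 0 ^ 2 ∂(gaussianReal 0 1) := integral_nonneg fun _ => sq_nonneg _
  positivity

theorem sqrt_two_div_pi_mul_sqrt_pi_div_two : √(2 / Real.pi) * √(Real.pi / 2) = 1 := by
  rw [← Real.sqrt_mul (by positivity)]
  have := Real.pi_ne_zero
  field_simp
  simp

theorem psiObjective_zero (ρ : ℝ) : psiObjective ρ 0 = 1 := by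
  simp only [psiObjective, integral_Ioi_zero_exp_neg_sq_div_two]
  linear_combination (1 - ρ) * sqrt_two_div_pi_mul_sqrt_pi_div_two

theorem isGLB_psi {ρ : ℝ} (hρ : ρ ∈ Icc (0 : ℝ) 1) : IsGLB (psiObjective ρ '' Ici 0) (psi ρ) :=
  Real.isGLB_sInf ⟨_, mem_image_of_mem _ self_mem_Ici⟩
    ⟨0, by rintro _ ⟨t, ht, rfl⟩; exact psiObjective_nonneg hρ ht⟩

theorem psi_mem_Icc {ρ : ℝ} (hρ : ρ ∈ Icc (0 : ℝ) 1) : psi ρ ∈ Icc (0 : ℝ) 1 :=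
  ⟨(isGLB_psi hρ).2 (by rintro _ ⟨t, ht, rfl⟩; exact psiObjective_nonneg hρ ht),
    psiObjective_zero ρ ▸ (isGLB_psi hρ).1 (mem_image_of_mem _ self_mem_Ici)⟩

/-- The left-hand side of the stationary equation. -/
noncomputable def stationaryFun (t : ℝ) : ℝ :=
  1 / t * Real.exp (-t ^ 2 / 2) - ∫ u in Ioi t, Real.exp (-u ^ 2 / 2)

theorem hasDerivAt_stationaryFun {t : ℝ} (ht : 0 < t) :
    HasDerivAt stationaryFun (-(Real.exp (-t ^ 2 / 2) / t ^ 2)) t := by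
  have h := ((hasDerivAt_inv ht.ne').mul (hasDerivAt_exp_neg_sq_div_two t)).sub
    (hasDerivAt_integral_Ioi_exp_neg_sq_div_two t)
  have he : stationaryFun = (fun y => y⁻¹ * Real.exp (-y ^ 2 / 2)) -
      fun a => ∫ u in Ioi a, Real.exp (-u ^ 2 / 2) := by
    ext y
    simp [stationaryFun]
  rw [he]
  refine h.congr_deriv ?_
  field_simp
  ring

theorem continuousOn_stationaryFun : ContinuousOn stationaryFun (Ioi 0) := fun _ ht =>
  (hasDerivAt_stationaryFun ht).continuousAt.continuousWithinAt

theorem strictAntiOn_stationaryFun : StrictAntiOn stationaryFun (Ioi 0) := by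
  refine strictAntiOn_of_deriv_neg (convex_Ioi 0) continuousOn_stationaryFun fun t ht => ?_
  rw [interior_Ioi] at ht
  have : 0 < t := ht
  rw [(hasDerivAt_stationaryFun ht).deriv, neg_lt_zero]
  positivity

theorem exists_stationaryFun_eq {r : ℝ} (hr : 0 < r) : ∃ t, 0 < t ∧ stationaryFun t = r := by
  have hpi : 0 ≤ √(Real.pi / 2) := Real.sqrt_nonneg _
  -- near `0` the term `exp (-t²/2) / t` exceeds `r` plus the bound `√(π/2)` of the tail integral
  set a : ℝ := min 1 (Real.exp (-1 / 2) / (r + √(Real.pi / 2))) with ha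
  have ha0 : 0 < a := lt_min one_pos (by positivity)
  have hfa : r ≤ stationaryFun a := by
    have h1 : Real.exp (-1 / 2) ≤ Real.exp (-a ^ 2 / 2) := by
      gcongr
      nlinarith [min_le_left (1 : ℝ) (Real.exp (-1 / 2) / (r + √(Real.pi / 2)))]
    have h2 : r + √(Real.pi / 2) ≤ 1 / a * Real.exp (-a ^ 2 / 2) := by
      rw [one_div, inv_mul_eq_div, le_div_iff₀ ha0]
      refine le_trans ?_ h1
      rw [mul_comm, ← le_div_iff₀ (by positivity)]
      exact min_le_right _ _
    have h3 := integral_Ioi_exp_neg_sq_div_two_le ha0.le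
    rw [stationaryFun]
    linarith
  have hfb : stationaryFun r⁻¹ ≤ r := by
    have h1 : Real.exp (-r⁻¹ ^ 2 / 2) ≤ 1 := Real.exp_le_one_iff.2 (by
      have := sq_nonneg r⁻¹
      linarith)
    have h2 := integral_Ioi_exp_neg_sq_div_two_nonneg r⁻¹
    rw [stationaryFun, one_div, inv_inv]
    nlinarith
  obtain ⟨t, ht, hrt⟩ := isPreconnected_Ioi.intermediate_value (inv_pos.2 hr) ha0
    continuousOn_stationaryFun ⟨hfb, hfa⟩
  exact ⟨t, ht, hrt⟩

theorem hasDerivAt_psiObjective (ρ t : ℝ) :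
    HasDerivAt (psiObjective ρ) (2 * ρ * t + (1 - ρ) * √(2 / Real.pi) *
      (2 * t * (∫ u in Ioi t, Real.exp (-u ^ 2 / 2)) - 2 * Real.exp (-t ^ 2 / 2))) t := by
  have hsq : HasDerivAt (fun t : ℝ => 1 + t ^ 2) (2 * t) t := by
    simpa using (hasDerivAt_pow 2 t).const_add 1
  have h := (hsq.const_mul ρ).add (((hsq.mul (hasDerivAt_integral_Ioi_exp_neg_sq_div_two t)).sub
    ((hasDerivAt_id t).mul (hasDerivAt_exp_neg_sq_div_two t))).const_mul
      ((1 - ρ) * √(2 / Real.pi)))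
  refine h.congr_deriv ?_
  simp only [id]
  ring

/-- The sign of the derivative of `psiObjective ρ` on `(0, ∞)` is that of the defect in the
stationary equation. -/
theorem deriv_psiObjective {ρ t : ℝ} (hρ : ρ < 1) (ht : 0 < t) :
    deriv (psiObjective ρ) t = 2 * t * (1 - ρ) * √(2 / Real.pi) *
      (√(Real.pi / 2) * (ρ / (1 - ρ)) - stationaryFun t) := by
  have h1 : 1 - ρ ≠ 0 := (sub_pos.2 hρ).ne'
  have h2 := sqrt_two_div_pi_mul_sqrt_pi_div_two
  have h3 : t * (1 / t) = 1 := mul_one_div_cancel ht.ne'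
  have h4 : (1 - ρ) * (ρ / (1 - ρ)) = ρ := mul_div_cancel₀ _ h1
  rw [(hasDerivAt_psiObjective ρ t).deriv, stationaryFun]
  linear_combination (-2 * t * ρ) * h2 -
    2 * t * √(2 / Real.pi) * √(Real.pi / 2) * h4 +
    2 * (1 - ρ) * √(2 / Real.pi) * Real.exp (-t ^ 2 / 2) * h3

theorem exists_unique_stationary_minimizer {ρ : ℝ} (hρ : ρ ∈ Ioo (0 : ℝ) 1) :
    ∃ τ : ℝ, 0 < τ ∧ (∀ t : ℝ, 0 < t → (IsStationaryTau ρ t ↔ t = τ)) ∧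
      (∀ t : ℝ, 0 ≤ t → (psiObjective ρ t = psi ρ ↔ t = τ)) := by
  have h1 : 0 < 1 - ρ := sub_pos.2 hρ.2
  have hr : 0 < √(Real.pi / 2) * (ρ / (1 - ρ)) :=
    mul_pos (Real.sqrt_pos.2 (by positivity)) (div_pos hρ.1 h1)
  obtain ⟨τ, hτ, hτr⟩ := exists_stationaryFun_eq hr
  have hc : 0 < √(2 / Real.pi) := Real.sqrt_pos.2 (by positivity)
  have hcont : Continuous (psiObjective ρ) := continuous_iff_continuousAt.2 fun t =>
    (hasDerivAt_psiObjective ρ t).continuousAt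
  have hanti : StrictAntiOn (psiObjective ρ) (Icc 0 τ) := by
    refine strictAntiOn_of_deriv_neg (convex_Icc _ _) hcont.continuousOn fun t ht => ?_
    rw [interior_Icc] at ht
    have ht0 := ht.1
    rw [deriv_psiObjective hρ.2 ht.1]
    refine mul_neg_of_pos_of_neg (by positivity) (sub_neg.2 ?_)
    rw [← hτr]
    exact strictAntiOn_stationaryFun ht.1 hτ ht.2
  have hmono : StrictMonoOn (psiObjective ρ) (Ici τ) := by
    refine strictMonoOn_of_deriv_pos (convex_Ici _) hcont.continuousOn fun t ht => ?_
    rw [interior_Ici] at ht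
    have ht0 : 0 < t := hτ.trans ht
    rw [deriv_psiObjective hρ.2 ht0]
    refine mul_pos (by positivity) (sub_pos.2 ?_)
    rw [← hτr]
    exact strictAntiOn_stationaryFun hτ ht0 ht
  have hlt : ∀ t, 0 ≤ t → t ≠ τ → psiObjective ρ τ < psiObjective ρ t := fun t ht hne => by
    rcases hne.lt_or_gt with h | h
    · exact hanti ⟨ht, h.le⟩ (right_mem_Icc.2 hτ.le) h
    · exact hmono self_mem_Ici h.le h
  have hpsi : psi ρ = psiObjective ρ τ := by
    refine (isGLB_psi (Ioo_subset_Icc_self hρ)).unique (IsLeast.isGLB ⟨⟨τ, hτ.le, rfl⟩, ?_⟩)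
    rintro _ ⟨t, ht, rfl⟩
    rcases eq_or_ne t τ with rfl | hne
    · exact le_rfl
    · exact (hlt t ht hne).le
  refine ⟨τ, hτ, fun t ht => ?_, fun t ht => ⟨fun h => ?_, fun h => by rw [h, hpsi]⟩⟩
  · rw [IsStationaryTau, ← hτr]
    exact strictAntiOn_stationaryFun.injOn.eq_iff ht hτ
  · by_contra hne
    exact (hlt t ht hne).ne' (h.trans hpsi)

end Psi

/-! ### Euclidean projections onto closed convex cones -/

section Projection

variable {d : ℕ} {K : Set (EuclideanSpace ℝ (Fin d))}

/-- The variational inequality characterizes the Euclidean projection. -/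
theorem euclideanProj_eq_iff_inner_le_zero (hne : K.Nonempty) (hc : IsClosed K)
    (hconv : Convex ℝ K) (x y : EuclideanSpace ℝ (Fin d)) :
    euclideanProj K x = y ↔ y ∈ K ∧ ∀ z ∈ K, inner ℝ (x - y) (z - y) ≤ 0 := by
  rw [euclideanProj_eq_iff hne hc hconv]
  refine and_congr_right fun hy => ?_
  rw [← norm_eq_iInf_iff_real_inner_le_zero hconv hy]
  have hbdd : BddBelow (range fun w : K => ‖x - w‖) := ⟨0, by rintro _ ⟨w, rfl⟩; positivity⟩
  have : Nonempty K := ⟨⟨y, hy⟩⟩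
  exact ⟨fun h => le_antisymm (le_ciInf fun w => h w w.2) (ciInf_le hbdd ⟨y, hy⟩),
    fun h z hz => h ▸ ciInf_le hbdd ⟨z, hz⟩⟩

theorem euclideanProj_mem (hne : K.Nonempty) (hc : IsClosed K) (hconv : Convex ℝ K)
    (x : EuclideanSpace ℝ (Fin d)) : euclideanProj K x ∈ K :=
  ((euclideanProj_eq_iff_inner_le_zero hne hc hconv x _).1 rfl).1

theorem inner_sub_euclideanProj_le (hne : K.Nonempty) (hc : IsClosed K) (hconv : Convex ℝ K)
    (x : EuclideanSpace ℝ (Fin d)) {z : EuclideanSpace ℝ (Fin d)} (hz : z ∈ K) :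
    inner ℝ (x - euclideanProj K x) (z - euclideanProj K x) ≤ 0 :=
  ((euclideanProj_eq_iff_inner_le_zero hne hc hconv x _).1 rfl).2 z hz

/-- Firm nonexpansiveness of the projection. -/
theorem inner_euclideanProj_sub_nonneg (hne : K.Nonempty) (hc : IsClosed K) (hconv : Convex ℝ K)
    (u v : EuclideanSpace ℝ (Fin d)) :
    0 ≤ inner ℝ ((u - euclideanProj K u) - (v - euclideanProj K v))
      (euclideanProj K u - euclideanProj K v) := by
  have h1 := inner_sub_euclideanProj_le hne hc hconv u (euclideanProj_mem hne hc hconv v)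
  have h2 := inner_sub_euclideanProj_le hne hc hconv v (euclideanProj_mem hne hc hconv u)
  rw [inner_sub_left, ← neg_sub (euclideanProj K v) (euclideanProj K u), inner_neg_right]
  rw [← neg_sub (euclideanProj K v) (euclideanProj K u), inner_neg_right] at h2
  rw [inner_neg_right]
  linarith

theorem lipschitzWith_euclideanProj (hne : K.Nonempty) (hc : IsClosed K) (hconv : Convex ℝ K) :
    LipschitzWith 1 (euclideanProj K) := by
  refine LipschitzWith.of_dist_le_mul fun u v => ?_
  have h := inner_euclideanProj_sub_nonneg hne hc hconv u v
  set a := euclideanProj K u - euclideanProj K v with ha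
  rw [show (u - euclideanProj K u) - (v - euclideanProj K v) = (u - v) - a by rw [ha]; abel,
    inner_sub_left, real_inner_self_eq_norm_sq] at h
  have h2 := real_inner_le_norm (u - v) a
  rw [dist_eq_norm, dist_eq_norm, NNReal.coe_one, one_mul, ← ha]
  nlinarith [norm_nonneg a, norm_nonneg (u - v)]

theorem lipschitzWith_sub_euclideanProj (hne : K.Nonempty) (hc : IsClosed K)
    (hconv : Convex ℝ K) : LipschitzWith 1 (fun u => u - euclideanProj K u) := by
  refine LipschitzWith.of_dist_le_mul fun u v => ?_
  have h := inner_euclideanProj_sub_nonneg hne hc hconv u v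
  set b := (u - euclideanProj K u) - (v - euclideanProj K v) with hb
  rw [show euclideanProj K u - euclideanProj K v = (u - v) - b by rw [hb]; abel,
    inner_sub_right, real_inner_self_eq_norm_sq] at h
  have h2 := real_inner_le_norm b (u - v)
  rw [dist_eq_norm, dist_eq_norm, NNReal.coe_one, one_mul, ← hb]
  nlinarith [norm_nonneg b, norm_nonneg (u - v)]

theorem integrable_norm_euclideanProj_sq (hne : K.Nonempty) (hc : IsClosed K)
    (hconv : Convex ℝ K) :
    Integrable (fun g => ‖euclideanProj K g‖ ^ 2) (stdGaussian (EuclideanSpace ℝ (Fin d))) :=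
  (lipschitzWith_one_norm.comp
    (lipschitzWith_euclideanProj hne hc hconv)).memLp_of_isGaussian.integrable_sq

/-- Complementary slackness in Moreau's decomposition. -/
theorem inner_sub_euclideanProj_self (hne : K.Nonempty) (hc : IsClosed K) (hconv : Convex ℝ K)
    (hsmul : ∀ r : ℝ, 0 ≤ r → ∀ y ∈ K, r • y ∈ K) (x : EuclideanSpace ℝ (Fin d)) :
    inner ℝ (x - euclideanProj K x) (euclideanProj K x) = 0 := by
  have hp := euclideanProj_mem hne hc hconv x
  have h0 := inner_sub_euclideanProj_le hne hc hconv x (hsmul 0 le_rfl _ hp)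
  have h2 := inner_sub_euclideanProj_le hne hc hconv x (hsmul 2 zero_le_two _ hp)
  rw [zero_smul, zero_sub, inner_neg_right] at h0
  rw [two_smul, add_sub_cancel_right] at h2
  linarith

end Projection

/-! ### The descent cone of the `ℓ₁` norm -/

section DescentCone

variable {d : ℕ} (S : Finset (Fin d)) (e : Fin d → ℝ)

/-- The directional derivative of the `ℓ₁` norm, in direction `y`, at any point with support `S` and
signs `e` on `S`. -/
noncomputable def l1Deriv (y : EuclideanSpace ℝ (Fin d)) : ℝ :=
  ∑ i, if i ∈ S then e i * y i else |y i|

/-- The cone of directions in which the `ℓ₁` norm does not increase to first order. -/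
def l1Cone : Set (EuclideanSpace ℝ (Fin d)) := {y | l1Deriv S e y ≤ 0}

theorem continuous_l1Deriv : Continuous (l1Deriv S e) := by
  refine continuous_finsetSum _ fun i _ => ?_
  split_ifs <;> fun_prop

theorem l1Deriv_smul {r : ℝ} (hr : 0 ≤ r) (y : EuclideanSpace ℝ (Fin d)) :
    l1Deriv S e (r • y) = r * l1Deriv S e y := by
  simp only [l1Deriv, Finset.mul_sum, PiLp.smul_apply, smul_eq_mul, abs_mul, abs_of_nonneg hr]
  refine Finset.sum_congr rfl fun i _ => ?_
  split_ifs <;> ring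

theorem l1Deriv_add_le (y z : EuclideanSpace ℝ (Fin d)) :
    l1Deriv S e (y + z) ≤ l1Deriv S e y + l1Deriv S e z := by
  simp only [l1Deriv, ← Finset.sum_add_distrib, PiLp.add_apply]
  refine Finset.sum_le_sum fun i _ => ?_
  split_ifs
  · rw [mul_add]
  · exact abs_add_le _ _

theorem l1Cone_nonempty : (l1Cone S e).Nonempty := ⟨0, by simp [l1Cone, l1Deriv]⟩

theorem isClosed_l1Cone : IsClosed (l1Cone S e) :=
  isClosed_le (continuous_l1Deriv S e) continuous_const

theorem smul_mem_l1Cone {r : ℝ} (hr : 0 ≤ r) {y : EuclideanSpace ℝ (Fin d)}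
    (hy : y ∈ l1Cone S e) : r • y ∈ l1Cone S e := by
  rw [l1Cone, mem_ofPred_eq, l1Deriv_smul S e hr]
  exact mul_nonpos_of_nonneg_of_nonpos hr hy

theorem convex_l1Cone : Convex ℝ (l1Cone S e) := by
  intro y hy z hz a b ha hb _
  have h1 : l1Deriv S e (a • y) ≤ 0 := smul_mem_l1Cone S e ha hy
  have h2 : l1Deriv S e (b • z) ≤ 0 := smul_mem_l1Cone S e hb hz
  exact (l1Deriv_add_le S e _ _).trans (add_nonpos h1 h2)

/-- Since the `ℓ₁` norm is piecewise linear, its descent cone is closed and determined by the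
directional derivative. -/
theorem descentCone_l1norm (x : EuclideanSpace ℝ (Fin d)) (hS : ∀ i, i ∈ S ↔ x i ≠ 0)
    (he : ∀ i ∈ S, e i ^ 2 = 1) (hex : ∀ i ∈ S, e i * x i = |x i|) :
    descentCone l1norm x = l1Cone S e := by
  ext y
  simp only [descentCone, mem_iUnion, mem_ofPred_eq, Subtype.exists, exists_prop, l1Cone]
  have he1 : ∀ i ∈ S, |e i| = 1 := fun i hi =>
    (pow_eq_one_iff_of_nonneg (abs_nonneg _) two_ne_zero).1 (by rw [sq_abs, he i hi])
  constructor
  · rintro ⟨t, ht, h⟩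
    have h1 : l1norm x + t * l1Deriv S e y ≤ l1norm (x + t • y) := by
      rw [l1norm, l1norm, l1Deriv, Finset.mul_sum, ← Finset.sum_add_distrib]
      refine Finset.sum_le_sum fun i _ => ?_
      simp only [PiLp.add_apply, PiLp.smul_apply, smul_eq_mul]
      split_ifs with hi
      · rw [← hex i hi]
        calc e i * x i + t * (e i * y i) = e i * (x i + t * y i) := by ring
          _ ≤ |e i * (x i + t * y i)| := le_abs_self _
          _ = |x i + t * y i| := by rw [abs_mul, he1 i hi, one_mul]
      · have : x i = 0 := by
          by_contra h0
          exact hi ((hS i).2 h0)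
        rw [this, zero_add, abs_zero, zero_add, abs_mul, abs_of_pos ht]
    have h2 : t * l1Deriv S e y ≤ 0 := by linarith
    exact nonpos_of_mul_nonpos_right h2 ht
  · intro h
    -- a step short enough that no coordinate in the support changes its sign
    have hstep : ∃ t : ℝ, 0 < t ∧ ∀ i ∈ S, t * |y i| ≤ |x i| := by
      have hev : ∀ᶠ t : ℝ in nhdsWithin 0 (Ioi 0), ∀ i ∈ S, t * |y i| ≤ |x i| := by
        refine (S.eventually_all).2 fun i hi => ?_
        have hc : ContinuousAt (fun t : ℝ => t * |y i|) 0 := by fun_prop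
        have hlt : (0 : ℝ) * |y i| < |x i| := by
          rw [zero_mul]
          exact abs_pos.2 ((hS i).1 hi)
        exact ((hc.eventually_lt_const hlt).mono fun _ => le_of_lt).filter_mono
          nhdsWithin_le_nhds
      obtain ⟨t, ht, ht0⟩ := (hev.and self_mem_nhdsWithin).exists
      exact ⟨t, ht0, ht⟩
    obtain ⟨t, ht, hty⟩ := hstep
    refine ⟨t, ht, ?_⟩
    have h1 : l1norm (x + t • y) = l1norm x + t * l1Deriv S e y := by
      rw [l1norm, l1norm, l1Deriv, Finset.mul_sum, ← Finset.sum_add_distrib]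
      refine Finset.sum_congr rfl fun i _ => ?_
      simp only [PiLp.add_apply, PiLp.smul_apply, smul_eq_mul]
      split_ifs with hi
      · have h2 : 0 ≤ e i * (x i + t * y i) := by
          have h3 : -(e i * (t * y i)) ≤ t * |y i| := by
            refine (neg_le_abs _).trans ?_
            rw [abs_mul, he1 i hi, one_mul, abs_mul, abs_of_pos ht]
          have h4 := hty i hi
          rw [← hex i hi] at h4
          linarith
        rw [← hex i hi, ← one_mul |x i + t * y i|, ← he1 i hi, ← abs_mul, abs_of_nonneg h2]
        ring
      · have : x i = 0 := by
          by_contra h0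
          exact hi ((hS i).2 h0)
        rw [this, zero_add, abs_zero, zero_add, abs_mul, abs_of_pos ht]
    have h2 : t * l1Deriv S e y ≤ 0 := mul_nonpos_of_nonneg_of_nonpos ht.le h
    linarith

end DescentCone

/-! ### Soft thresholding and the projection onto the descent cone -/

section SoftThreshold

variable {d : ℕ} (S : Finset (Fin d)) (e : Fin d → ℝ)

/-- The point nearest to `g` in the dilate `t ∂‖·‖₁` of the subdifferential of the `ℓ₁` norm at a
point with support `S` and signs `e`, for `t ≥ 0`: it is `t e` on `S`, and `g` clipped to `[-t, t]`
off `S`. -/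
noncomputable def l1Clip (g : EuclideanSpace ℝ (Fin d)) (t : ℝ) : EuclideanSpace ℝ (Fin d) :=
  WithLp.toLp 2 fun i => if i ∈ S then t * e i else max (-t) (min t (g i))

/-- The squared distance from `g` to `t ∂‖·‖₁`, for `t ≥ 0` and `eᵢ = ±1` on `S`. -/
noncomputable def l1DistSq (g : EuclideanSpace ℝ (Fin d)) (t : ℝ) : ℝ :=
  ∑ i, if i ∈ S then (e i * g i - t) ^ 2 else max (|g i| - t) 0 ^ 2

/-- Minus one half of the derivative of `l1DistSq S e g` at `t`. -/
noncomputable def l1Slope (g : EuclideanSpace ℝ (Fin d)) (t : ℝ) : ℝ :=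
  ∑ i, if i ∈ S then e i * g i - t else max (|g i| - t) 0

theorem abs_sub_clip {t : ℝ} (ht : 0 ≤ t) (a : ℝ) :
    |a - max (-t) (min t a)| = max (|a| - t) 0 := by
  grind

theorem clip_mul_le {t : ℝ} (ht : 0 ≤ t) (a z : ℝ) : max (-t) (min t a) * z ≤ t * |z| := by
  have h : |max (-t) (min t a)| ≤ t := abs_le.2 ⟨le_max_left _ _, max_le (by linarith)
    (min_le_left _ _)⟩
  calc max (-t) (min t a) * z ≤ |max (-t) (min t a) * z| := le_abs_self _
    _ = |max (-t) (min t a)| * |z| := abs_mul _ _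
    _ ≤ t * |z| := by gcongr

theorem clip_mul_sub {t : ℝ} (ht : 0 ≤ t) (a : ℝ) :
    max (-t) (min t a) * (a - max (-t) (min t a)) = t * |a - max (-t) (min t a)| := by
  rcases le_total a (-t) with h | h
  · rw [min_eq_right (by linarith), max_eq_left h, abs_of_nonpos (by linarith)]
    ring
  · rcases le_total a t with h' | h'
    · rw [min_eq_right h', max_eq_right h]
      simp
    · rw [min_eq_left h', max_eq_right (by linarith), abs_of_nonneg (by linarith)]

variable {S e}

theorem norm_sub_l1Clip_sq (he : ∀ i ∈ S, e i ^ 2 = 1) (g : EuclideanSpace ℝ (Fin d)) {t : ℝ}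
    (ht : 0 ≤ t) : ‖g - l1Clip S e g t‖ ^ 2 = l1DistSq S e g t := by
  rw [EuclideanSpace.real_norm_sq_eq, l1DistSq]
  refine Finset.sum_congr rfl fun i _ => ?_
  simp only [l1Clip, PiLp.sub_apply]
  split_ifs with hi
  · linear_combination (t ^ 2 - g i ^ 2) * he i hi
  · rw [← abs_sub_clip ht, sq_abs]

theorem inner_l1Clip_le (g z : EuclideanSpace ℝ (Fin d)) {t : ℝ} (ht : 0 ≤ t) :
    inner ℝ (l1Clip S e g t) z ≤ t * l1Deriv S e z := by
  rw [PiLp.inner_apply, l1Deriv, Finset.mul_sum]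
  refine Finset.sum_le_sum fun i _ => ?_
  simp only [l1Clip, RCLike.inner_apply, conj_trivial]
  split_ifs with hi
  · exact le_of_eq (by ring)
  · rw [mul_comm]
    exact clip_mul_le ht _ _

theorem l1Deriv_sub_l1Clip (he : ∀ i ∈ S, e i ^ 2 = 1) (g : EuclideanSpace ℝ (Fin d)) {t : ℝ}
    (ht : 0 ≤ t) : l1Deriv S e (g - l1Clip S e g t) = l1Slope S e g t := by
  refine Finset.sum_congr rfl fun i _ => ?_
  simp only [l1Clip, PiLp.sub_apply]
  split_ifs with hi
  · linear_combination (-t) * he i hi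
  · exact abs_sub_clip ht _

theorem inner_l1Clip_sub (g : EuclideanSpace ℝ (Fin d)) {t : ℝ}
    (ht : 0 ≤ t) :
    inner ℝ (l1Clip S e g t) (g - l1Clip S e g t) = t * l1Deriv S e (g - l1Clip S e g t) := by
  rw [PiLp.inner_apply, l1Deriv, Finset.mul_sum]
  refine Finset.sum_congr rfl fun i _ => ?_
  simp only [l1Clip, PiLp.sub_apply, RCLike.inner_apply, conj_trivial]
  split_ifs with hi
  · ring
  · rw [mul_comm, clip_mul_sub ht]

/-- The squared norm of the projection onto a cone is at most the squared distance to any set in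
the polar cone, here to `t ∂‖·‖₁`. -/
theorem norm_euclideanProj_l1Cone_sq_le (he : ∀ i ∈ S, e i ^ 2 = 1)
    (g : EuclideanSpace ℝ (Fin d)) {t : ℝ} (ht : 0 ≤ t) :
    ‖euclideanProj (l1Cone S e) g‖ ^ 2 ≤ l1DistSq S e g t := by
  have hp : l1Deriv S e (euclideanProj (l1Cone S e) g) ≤ 0 :=
    euclideanProj_mem (l1Cone_nonempty S e) (isClosed_l1Cone S e) (convex_l1Cone S e) g
  have h1 := inner_sub_euclideanProj_self (l1Cone_nonempty S e) (isClosed_l1Cone S e)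
    (convex_l1Cone S e) (fun r hr y hy => smul_mem_l1Cone S e hr hy) g
  have h2 := inner_l1Clip_le (S := S) (e := e) g (euclideanProj (l1Cone S e) g) ht
  have h3 := mul_nonpos_of_nonneg_of_nonpos ht hp
  rw [← norm_sub_l1Clip_sq he g ht]
  set p := euclideanProj (l1Cone S e) g
  have h4 : g - l1Clip S e g t = p + ((g - p) - l1Clip S e g t) := by abel
  have h5 : inner ℝ p ((g - p) - l1Clip S e g t) = - inner ℝ (l1Clip S e g t) p := by
    rw [inner_sub_right, real_inner_comm, h1, real_inner_comm]
    ring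
  rw [h4, norm_add_sq_real, h5]
  nlinarith [sq_nonneg ‖(g - p) - l1Clip S e g t‖]

/-- The optimality conditions for minimizing the squared distance over `t ≥ 0` can be met. -/
theorem exists_l1Slope_complementary (he : ∀ i ∈ S, e i ^ 2 = 1)
    (g : EuclideanSpace ℝ (Fin d)) :
    ∃ t, 0 ≤ t ∧ l1Slope S e g t ≤ 0 ∧ t * l1Slope S e g t = 0 := by
  rcases le_total (l1Slope S e g 0) 0 with h0 | h0
  · exact ⟨0, le_rfl, h0, zero_mul _⟩
  have hle : ∀ i, |g i| ≤ ∑ j, |g j| := fun i =>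
    Finset.single_le_sum (f := fun j => |g j|) (fun j _ => abs_nonneg _) (Finset.mem_univ i)
  have hT : l1Slope S e g (∑ j, |g j|) ≤ 0 := by
    refine Finset.sum_nonpos fun i _ => ?_
    split_ifs with hi
    · have h1 : |e i| = 1 :=
        (pow_eq_one_iff_of_nonneg (abs_nonneg _) two_ne_zero).1 (by rw [sq_abs, he i hi])
      have h2 := le_abs_self (e i * g i)
      rw [abs_mul, h1, one_mul] at h2
      linarith [hle i]
    · rw [max_eq_right (sub_nonpos.2 (hle i))]
  have hcont : Continuous (l1Slope S e g) := by
    refine continuous_finsetSum _ fun i _ => ?_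
    split_ifs <;> fun_prop
  obtain ⟨t, ht, htz⟩ := intermediate_value_Icc' (Finset.sum_nonneg fun j _ => abs_nonneg (g j))
    hcont.continuousOn ⟨hT, h0⟩
  exact ⟨t, ht.1, htz.le, by rw [htz, mul_zero]⟩

theorem euclideanProj_l1Cone_eq (he : ∀ i ∈ S, e i ^ 2 = 1) (g : EuclideanSpace ℝ (Fin d)) {t : ℝ}
    (ht : 0 ≤ t) (hs : l1Slope S e g t ≤ 0) (hts : t * l1Slope S e g t = 0) :
    euclideanProj (l1Cone S e) g = g - l1Clip S e g t := by
  have h := l1Deriv_sub_l1Clip he g ht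
  rw [euclideanProj_eq_iff_inner_le_zero (l1Cone_nonempty S e) (isClosed_l1Cone S e)
    (convex_l1Cone S e)]
  refine ⟨?_, fun z hz => ?_⟩
  · rw [l1Cone, mem_ofPred_eq, h]
    exact hs
  · have hz' : l1Deriv S e z ≤ 0 := hz
    rw [sub_sub_cancel, inner_sub_right, inner_l1Clip_sub g ht, h, hts, sub_zero]
    exact (inner_l1Clip_le g z ht).trans (mul_nonpos_of_nonneg_of_nonpos ht hz')

variable (S e)

/-- The threshold `t ≥ 0` at which `g` is nearest to `t ∂‖·‖₁`, read off from the polar part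
`g - Π(g)` of the projection of `g` onto the descent cone, which equals `t e` on `S`. It
is meaningful for nonempty `S` only, and `0` otherwise. -/
noncomputable def l1Threshold (g : EuclideanSpace ℝ (Fin d)) : ℝ :=
  (∑ i ∈ S, e i * (g - euclideanProj (l1Cone S e) g) i) / S.card

variable {S e}

theorem l1Threshold_spec (he : ∀ i ∈ S, e i ^ 2 = 1) (hS : S.Nonempty)
    (g : EuclideanSpace ℝ (Fin d)) :
    0 ≤ l1Threshold S e g ∧
      l1DistSq S e g (l1Threshold S e g) = ‖euclideanProj (l1Cone S e) g‖ ^ 2 := by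
  obtain ⟨t, ht, hs, hts⟩ := exists_l1Slope_complementary he g
  have hp := euclideanProj_l1Cone_eq he g ht hs hts
  have hcard : (S.card : ℝ) ≠ 0 := Nat.cast_ne_zero.2 hS.card_pos.ne'
  have hτ : l1Threshold S e g = t := by
    rw [l1Threshold, hp, sub_sub_cancel, div_eq_iff hcard]
    have h1 : ∀ i ∈ S, e i * (l1Clip S e g t) i = t := fun i hi => by
      simp only [l1Clip, if_pos hi]
      linear_combination t * he i hi
    rw [Finset.sum_congr rfl h1, Finset.sum_const, nsmul_eq_mul, mul_comm]
  rw [hτ, hp, norm_sub_l1Clip_sq he g ht]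
  exact ⟨ht, rfl⟩

/-- The threshold depends on `g` with Lipschitz constant `1 / √|S|`: it is the polar part of `g`,
which is `1`-Lipschitz, paired with a vector of norm `1 / √|S|`. -/
theorem lipschitzWith_l1Threshold (he : ∀ i ∈ S, e i ^ 2 = 1) (hS : S.Nonempty) :
    LipschitzWith (Real.toNNReal (1 / √S.card)) (l1Threshold S e) := by
  refine LipschitzWith.of_dist_le_mul fun u v => ?_
  have hq := (lipschitzWith_sub_euclideanProj (l1Cone_nonempty S e) (isClosed_l1Cone S e)
    (convex_l1Cone S e)).dist_le_mul u v
  rw [NNReal.coe_one, one_mul, dist_eq_norm, dist_eq_norm] at hq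
  have hcard : (0 : ℝ) < S.card := Nat.cast_pos.2 hS.card_pos
  rw [Real.coe_toNNReal _ (by positivity), Real.dist_eq, l1Threshold, l1Threshold, ← sub_div,
    ← Finset.sum_sub_distrib, dist_eq_norm]
  set b := (u - euclideanProj (l1Cone S e) u) - (v - euclideanProj (l1Cone S e) v) with hb
  have h1 : ∑ i ∈ S, (e i * (u - euclideanProj (l1Cone S e) u) i -
      e i * (v - euclideanProj (l1Cone S e) v) i) = ∑ i ∈ S, e i * b i := by
    refine Finset.sum_congr rfl fun i _ => ?_
    rw [hb, ← mul_sub]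
    rfl
  rw [h1]
  have h2 : (∑ i ∈ S, e i * b i) ^ 2 ≤ S.card * ‖b‖ ^ 2 := by
    refine (Finset.sum_mul_sq_le_sq_mul_sq S e b).trans ?_
    rw [Finset.sum_congr rfl he, Finset.sum_const, nsmul_eq_mul, mul_one,
      EuclideanSpace.real_norm_sq_eq]
    gcongr
    exact Finset.subset_univ S
  have h3 : |∑ i ∈ S, e i * b i| ≤ √S.card * ‖u - v‖ := by
    refine abs_le_of_sq_le_sq (h2.trans ?_) (by positivity)
    rw [mul_pow, Real.sq_sqrt hcard.le]
    gcongr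
  rw [abs_div, abs_of_pos hcard, div_le_iff₀ hcard]
  refine h3.trans (le_of_eq ?_)
  have h4 : √(S.card : ℝ) ^ 2 = S.card := Real.sq_sqrt hcard.le
  have h5 : √(S.card : ℝ) ≠ 0 := (Real.sqrt_pos.2 hcard).ne'
  field_simp
  rw [h4, mul_comm]

/-- The gradient inequality for the convex function `l1DistSq S e g`. -/
theorem l1DistSq_sub_le (g : EuclideanSpace ℝ (Fin d)) (t t₀ : ℝ) :
    l1DistSq S e g t₀ - l1DistSq S e g t ≤ 2 * l1Slope S e g t₀ * (t - t₀) := by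
  rw [l1DistSq, l1DistSq, l1Slope, ← Finset.sum_sub_distrib, Finset.mul_sum, Finset.sum_mul]
  refine Finset.sum_le_sum fun i _ => ?_
  split_ifs with hi
  · nlinarith [sq_nonneg (t - t₀)]
  · rcases le_total (|g i| - t₀) 0 with h | h
    · rw [max_eq_right h]
      nlinarith [sq_nonneg (max (|g i| - t) 0)]
    · rw [max_eq_left h]
      rcases le_total (|g i| - t) 0 with h' | h'
      · rw [max_eq_right h']
        nlinarith
      · rw [max_eq_left h']
        nlinarith [sq_nonneg (t - t₀)]

end SoftThreshold

/-! ### The expected squared distance and the bounds on the statistical dimension -/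

section StatDim

variable {d : ℕ}

theorem measurePreserving_eval_stdGaussian (i : Fin d) :
    MeasurePreserving (fun g : EuclideanSpace ℝ (Fin d) => g i)
      (stdGaussian (EuclideanSpace ℝ (Fin d))) (gaussianReal 0 1) := by
  have h := measurePreserving_eval_multivariateGaussian (μ := 0) (i := i)
    (Matrix.PosSemidef.one (n := Fin d) (R := ℝ))
  simpa using h

theorem integral_eval_stdGaussian {φ : ℝ → ℝ} (hφ : Continuous φ) (i : Fin d) :
    ∫ g, φ (g i) ∂(stdGaussian (EuclideanSpace ℝ (Fin d))) = ∫ x, φ x ∂(gaussianReal 0 1) := by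
  have h := measurePreserving_eval_stdGaussian i
  rw [← h.map_eq, integral_map h.measurable.aemeasurable hφ.aestronglyMeasurable]

variable {S : Finset (Fin d)} {e : Fin d → ℝ}

theorem lipschitzWith_signed_sub {c : ℝ} (hc : c ^ 2 = 1) (t : ℝ) :
    LipschitzWith 1 fun a : ℝ => c * a - t := by
  refine LipschitzWith.of_dist_le_mul fun a b => ?_
  rw [Real.dist_eq, Real.dist_eq, sub_sub_sub_cancel_right, ← mul_sub, abs_mul,
    (pow_eq_one_iff_of_nonneg (abs_nonneg c) two_ne_zero).1 (by rw [sq_abs, hc])]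
  simp

theorem lipschitzWith_max_abs_sub (t : ℝ) : LipschitzWith 1 fun a : ℝ => max (|a| - t) 0 := by
  have h : LipschitzWith 1 fun a : ℝ => |a| - t := LipschitzWith.of_dist_le_mul fun a b => by
    simpa [Real.dist_eq] using abs_abs_sub_abs_le a b
  exact h.max_const 0

theorem integrable_comp_eval_sq {φ : ℝ → ℝ} (hφ : LipschitzWith 1 φ) (i : Fin d) :
    Integrable (fun g => φ (g i) ^ 2) (stdGaussian (EuclideanSpace ℝ (Fin d))) := by
  have h1 : LipschitzWith 1 fun g : EuclideanSpace ℝ (Fin d) => g i :=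
    LipschitzWith.of_dist_le_mul fun u v => by
      simpa [dist_eq_norm] using PiLp.norm_apply_le (u - v) i
  exact (hφ.comp h1).memLp_of_isGaussian.integrable_sq

theorem integrable_l1DistSq (he : ∀ i ∈ S, e i ^ 2 = 1) (t : ℝ) :
    Integrable (fun g => l1DistSq S e g t) (stdGaussian (EuclideanSpace ℝ (Fin d))) := by
  refine integrable_finsetSum _ fun i _ => ?_
  split_ifs with hi
  · exact integrable_comp_eval_sq (lipschitzWith_signed_sub (he i hi) t) i
  · exact integrable_comp_eval_sq (lipschitzWith_max_abs_sub t) i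

theorem integral_l1DistSq (hd : d ≠ 0) (he : ∀ i ∈ S, e i ^ 2 = 1) {t : ℝ} (ht : 0 ≤ t) :
    ∫ g, l1DistSq S e g t ∂(stdGaussian (EuclideanSpace ℝ (Fin d))) =
      d * psiObjective (S.card / d) t := by
  have hd' : (d : ℝ) ≠ 0 := Nat.cast_ne_zero.2 hd
  simp only [l1DistSq]
  rw [integral_finsetSum _ fun i _ => ?_]
  · have hterm : ∀ i, ∫ g, (if i ∈ S then (e i * g i - t) ^ 2 else max (|g i| - t) 0 ^ 2)
        ∂(stdGaussian (EuclideanSpace ℝ (Fin d))) =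
        if i ∈ S then 1 + t ^ 2 else ∫ x, max (|x| - t) 0 ^ 2 ∂(gaussianReal 0 1) := fun i => by
      split_ifs with hi
      · rw [← integral_sub_sq_gaussianReal (he i hi) t]
        exact integral_eval_stdGaussian (φ := fun x => (e i * x - t) ^ 2) (by fun_prop) i
      · exact integral_eval_stdGaussian (φ := fun x => max (|x| - t) 0 ^ 2) (by fun_prop) i
    have hcompl : ((Finset.univ.filter fun i => i ∉ S).card : ℝ) = d - S.card := by
      have h : Finset.univ.filter (fun i => i ∉ S) = Sᶜ := by
        ext i
        simp
      rw [h, Finset.card_compl, Fintype.card_fin,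
        Nat.cast_sub (by simpa using Finset.card_le_univ S)]
    rw [Finset.sum_congr rfl fun i _ => hterm i, Finset.sum_ite, Finset.sum_const,
      Finset.sum_const, nsmul_eq_mul, nsmul_eq_mul, hcompl, psiObjective_eq_integral _ ht]
    rw [Finset.filter_univ_mem]
    field_simp
  · split_ifs with hi
    · exact integrable_comp_eval_sq (lipschitzWith_signed_sub (he i hi) t) i
    · exact integrable_comp_eval_sq (lipschitzWith_max_abs_sub t) i

theorem statDim_l1Cone_eq : statDim (l1Cone S e) =
    ∫ g, ‖euclideanProj (l1Cone S e) g‖ ^ 2 ∂(stdGaussian (EuclideanSpace ℝ (Fin d))) := by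
  rw [statDim, (isClosed_l1Cone S e).closure_eq]

theorem card_div_mem_Icc (S : Finset (Fin d)) : (S.card / d : ℝ) ∈ Icc (0 : ℝ) 1 := by
  refine ⟨by positivity, div_le_one_of_le₀ ?_ (by positivity)⟩
  exact_mod_cast (by simpa using Finset.card_le_univ S)

theorem statDim_l1Cone_div_le (hd : d ≠ 0) (he : ∀ i ∈ S, e i ^ 2 = 1) :
    statDim (l1Cone S e) / d ≤ psi (S.card / d) := by
  have hd' : (0 : ℝ) < d := Nat.cast_pos.2 (Nat.pos_of_ne_zero hd)
  refine (isGLB_psi (card_div_mem_Icc S)).2 ?_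
  rintro _ ⟨t, ht, rfl⟩
  rw [div_le_iff₀' hd', ← integral_l1DistSq hd he ht, statDim_l1Cone_eq]
  exact integral_mono (integrable_norm_euclideanProj_sq (l1Cone_nonempty S e)
    (isClosed_l1Cone S e) (convex_l1Cone S e)) (integrable_l1DistSq he t)
    fun g => norm_euclideanProj_l1Cone_sq_le he g ht

theorem lipschitzWith_two_mul_l1Slope (he : ∀ i ∈ S, e i ^ 2 = 1) (t : ℝ) :
    LipschitzWith (Real.toNNReal (2 * √d)) fun g => 2 * l1Slope S e g t := by
  refine LipschitzWith.of_dist_le_mul fun u v => ?_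
  rw [Real.coe_toNNReal _ (by positivity), Real.dist_eq, ← mul_sub, abs_mul, dist_eq_norm]
  have h1 : |l1Slope S e u t - l1Slope S e v t| ≤ ∑ i, |(u - v) i| := by
    rw [l1Slope, l1Slope, ← Finset.sum_sub_distrib]
    refine (Finset.abs_sum_le_sum_abs _ _).trans (Finset.sum_le_sum fun i _ => ?_)
    split_ifs with hi
    · simpa [Real.dist_eq] using (lipschitzWith_signed_sub (he i hi) t).dist_le_mul (u i) (v i)
    · simpa [Real.dist_eq] using (lipschitzWith_max_abs_sub t).dist_le_mul (u i) (v i)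
  have h2 : ∑ i, |(u - v) i| ≤ √d * ‖u - v‖ := by
    refine le_of_sq_le_sq ?_ (by positivity)
    rw [mul_pow, Real.sq_sqrt (Nat.cast_nonneg d), EuclideanSpace.real_norm_sq_eq]
    have h3 := sq_sum_le_card_mul_sum_sq (s := Finset.univ) (f := fun i => |(u - v) i|)
    simpa using h3
  rw [abs_two, mul_assoc]
  exact mul_le_mul_of_nonneg_left (h1.trans h2) zero_le_two

theorem ae_differentiableAt_l1Slope (S : Finset (Fin d)) (e : Fin d → ℝ) (t : ℝ) :
    ∀ᵐ g ∂(stdGaussian (EuclideanSpace ℝ (Fin d))),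
      DifferentiableAt ℝ (fun g => 2 * l1Slope S e g t) g := by
  have hne : ∀ c : ℝ, ∀ᵐ x ∂(gaussianReal 0 1), x ≠ c := fun c => by
    have := nullSingletonClass_gaussianReal (μ := 0) (v := 1) one_ne_zero
    exact Measure.ae_ne _ c
  have hall : ∀ᵐ g ∂(stdGaussian (EuclideanSpace ℝ (Fin d))), ∀ i,
      g i ≠ 0 ∧ g i ≠ t ∧ g i ≠ -t := by
    refine ae_all_iff.2 fun i => ?_
    exact (measurePreserving_eval_stdGaussian i).quasiMeasurePreserving.ae
      ((hne 0).and ((hne t).and (hne (-t))))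
  filter_upwards [hall] with g hg
  refine DifferentiableAt.const_mul (DifferentiableAt.fun_sum fun i _ => ?_) _
  have hcoord : DifferentiableAt ℝ (fun g : EuclideanSpace ℝ (Fin d) => g i) g :=
    (EuclideanSpace.proj (𝕜 := ℝ) i).differentiableAt
  split_ifs with hi
  · exact (hcoord.const_mul (e i)).sub_const t
  · have h1 : DifferentiableAt ℝ (fun g : EuclideanSpace ℝ (Fin d) => |g i| - t) g :=
      (hcoord.abs (hg i).1).sub_const t
    have h2 : |g i| - t ≠ 0 := fun h => by
      rcases abs_choice (g i) with h' | h'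
      · exact (hg i).2.1 (by linarith)
      · exact (hg i).2.2 (by linarith)
    have h3 : (fun g : EuclideanSpace ℝ (Fin d) => max (|g i| - t) 0) =
        fun g => (2 : ℝ)⁻¹ * (|g i| - t + |(|g i| - t)|) := by
      ext g
      rcases le_total (|g i| - t) 0 with h | h
      · rw [max_eq_right h, abs_of_nonpos h]
        ring
      · rw [max_eq_left h, abs_of_nonneg h]
        ring
    rw [h3]
    exact (h1.fun_add (h1.abs h2)).const_mul (2 : ℝ)⁻¹

/-- The gap between the expected squared distance at the mean threshold and the statistical
dimension is controlled, by convexity, by the covariance of the optimal threshold with the slope of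
the squared distance at its mean. -/
theorem psi_sub_le_statDim_l1Cone_div (he : ∀ i ∈ S, e i ^ 2 = 1) (hS : S.Nonempty) :
    psi (S.card / d) - 2 / √(S.card * d) ≤ statDim (l1Cone S e) / d := by
  have hd : d ≠ 0 := by
    rintro rfl
    exact hS.choose.elim0
  have hd' : (0 : ℝ) < d := Nat.cast_pos.2 (Nat.pos_of_ne_zero hd)
  have hcard : (0 : ℝ) < S.card := Nat.cast_pos.2 hS.card_pos
  set γ := stdGaussian (EuclideanSpace ℝ (Fin d)) with hγ
  set τ := l1Threshold S e with hτ
  set t₀ := ∫ g, τ g ∂γ with ht₀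
  set h : EuclideanSpace ℝ (Fin d) → ℝ := fun g => 2 * l1Slope S e g t₀ with hh
  have hLτ := lipschitzWith_l1Threshold he hS
  have hLh := lipschitzWith_two_mul_l1Slope he t₀
  have hτ2 : MemLp τ 2 γ := hLτ.memLp_of_isGaussian
  have hh2 : MemLp h 2 γ := hLh.memLp_of_isGaussian
  have ht₀0 : 0 ≤ t₀ := integral_nonneg fun g => (l1Threshold_spec he hS g).1
  have hcov := covariance_stdGaussian_le_of_lipschitzWith hLτ hLh
    (ae_differentiableAt_l1Slope S e t₀)
  have hpoint : ∀ g, l1DistSq S e g t₀ - ‖euclideanProj (l1Cone S e) g‖ ^ 2 ≤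
      τ g * h g - t₀ * h g := fun g => by
    have h1 := l1DistSq_sub_le (S := S) (e := e) g (τ g) t₀
    rw [(l1Threshold_spec he hS g).2] at h1
    exact h1.trans (le_of_eq (by simp only [hh]; ring))
  have hproj := integrable_norm_euclideanProj_sq (l1Cone_nonempty S e)
    (isClosed_l1Cone S e) (convex_l1Cone S e)
  have hτh : Integrable (fun g => τ g * h g) γ := hτ2.integrable_mul hh2
  have hh1 : Integrable (fun g => t₀ * h g) γ := (hh2.integrable (by norm_num)).const_mul t₀
  -- integrated, the right-hand side of `hpoint` is the covariance of `τ` and `h`, as `t₀` is the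
  -- mean of `τ`
  have hmono := integral_mono ((integrable_l1DistSq he t₀).sub hproj) (hτh.sub hh1) hpoint
  simp only [Pi.sub_apply] at hmono
  rw [integral_sub (integrable_l1DistSq he t₀) hproj, integral_sub hτh hh1, integral_const_mul,
    integral_l1DistSq hd he ht₀0, ← statDim_l1Cone_eq] at hmono
  rw [Real.coe_toNNReal _ (by positivity), Real.coe_toNNReal _ (by positivity)] at hcov
  have hpsi : psi (S.card / d) ≤ psiObjective (S.card / d) t₀ :=
    (isGLB_psi (card_div_mem_Icc S)).1 (mem_image_of_mem _ ht₀0)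
  have hconst : 1 / √S.card * (2 * √d) = d * (2 / √(S.card * d)) := by
    have h1 : √(d : ℝ) ^ 2 = d := Real.sq_sqrt hd'.le
    have h2 : √(d : ℝ) ≠ 0 := (Real.sqrt_pos.2 hd').ne'
    have h3 : √(S.card : ℝ) ≠ 0 := (Real.sqrt_pos.2 hcard).ne'
    rw [Real.sqrt_mul hcard.le]
    field_simp
    exact h1
  rw [le_div_iff₀' hd', mul_sub, ← hconst]
  have h4 := mul_le_mul_of_nonneg_left hpsi hd'.le
  linarith

/-- The cone attached to the support and the signs of `x` is the descent cone at `x`. -/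
theorem exists_descentCone_l1norm_eq (x : EuclideanSpace ℝ (Fin d)) :
    ∃ (S : Finset (Fin d)) (e : Fin d → ℝ), S.card = {i | x i ≠ 0}.ncard ∧
      (∀ i ∈ S, e i ^ 2 = 1) ∧ descentCone l1norm x = l1Cone S e := by
  set S : Finset (Fin d) := Finset.univ.filter fun i => x i ≠ 0 with hS
  have hmem : ∀ i, i ∈ S ↔ x i ≠ 0 := fun i => by simp [hS]
  have he : ∀ i ∈ S, (|x i| / x i) ^ 2 = 1 := fun i hi => by
    rw [div_pow, sq_abs, div_self (pow_ne_zero 2 ((hmem i).1 hi))]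
  refine ⟨S, fun i => |x i| / x i, ?_, he, descentCone_l1norm S _ x hmem he fun i hi =>
    div_mul_cancel₀ _ ((hmem i).1 hi)⟩
  rw [← Set.ncard_coe_finset]
  congr 1
  ext i
  exact hmem i

end StatDim

theorem mainTheorem8 :
    -- bounds for the statistical dimension (a finite expectation)
    (∀ (d s : ℕ) (x : EuclideanSpace ℝ (Fin d)), 1 ≤ d → {i | x i ≠ 0}.ncard = s →
      Integrable (fun g => ‖euclideanProj (closure (descentCone l1norm x)) g‖ ^ 2)
        (stdGaussian (EuclideanSpace ℝ (Fin d))) ∧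
      (1 ≤ s → psi ((s : ℝ) / d) - 2 / √((s : ℝ) * d) ≤ statDim (descentCone l1norm x) / d) ∧
      statDim (descentCone l1norm x) / d ≤ psi ((s : ℝ) / d)) ∧
    -- `psi` is a genuine infimum on `[0, 1]`, with values in `[0, 1]`
    (∀ ρ ∈ Icc (0 : ℝ) 1, IsGLB (psiObjective ρ '' Ici 0) (psi ρ) ∧ psi ρ ∈ Icc (0 : ℝ) 1) ∧
    -- the stationary equation has a unique positive solution, which is the unique minimizer
    (∀ ρ ∈ Ioo (0 : ℝ) 1, ∃ τ : ℝ, 0 < τ ∧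
      (∀ t : ℝ, 0 < t → (IsStationaryTau ρ t ↔ t = τ)) ∧
      (∀ t : ℝ, 0 ≤ t → (psiObjective ρ t = psi ρ ↔ t = τ))) := by
  refine ⟨fun d s x hd hs => ?_, fun ρ hρ => ⟨isGLB_psi hρ, psi_mem_Icc hρ⟩,
    fun ρ hρ => exists_unique_stationary_minimizer hρ⟩
  obtain ⟨S, e, hcard, he, hcone⟩ := exists_descentCone_l1norm_eq x
  rw [hcone, (isClosed_l1Cone S e).closure_eq, ← hs, ← hcard]
  exact ⟨integrable_norm_euclideanProj_sq (l1Cone_nonempty S e) (isClosed_l1Cone S e)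
      (convex_l1Cone S e),
    fun h => psi_sub_le_statDim_l1Cone_div he (Finset.card_pos.1 h),
    statDim_l1Cone_div_le (Nat.one_le_iff_ne_zero.1 hd) he⟩
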